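/- Let $G=(V,E)$ be a finite simple unicyclic graph, i.e. $G$ is connected and $|E|=|V|$, and let $C=v_1v_2\ldots v_lv_1$ be its unique cycle. For $1\le k\le l$ let $T_k$ be the connected component containing $v_k$ of the graph obtained from $G$ by deleting the edges of $C$. For vertices $x,y$ let $d(x,y)$ be the graph distance, and let $H_{xy}$ be the expected value of the hitting time $T_y=\inf\{k\ge 0: X_k=y\}$ of the simple random walk $(X_k)_{k\ge0}$ on $G$ started at $X_0=x$ (which from its current vertex jumps to a uniformly chosen neighbour). The cover cost of $x$ is $CC(x)=\sum_{y\in V}H_{xy}$. Then for all $i,j\in\{1,\dots,l\}$ and all vertices $x$ of $T_i$ and $y$ of $T_j$, $$d(x,v_i)\le d(y,v_j)\quad\Longleftrightarrow\quad CC(x)\ge CC(y).$$ -/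

import Mathlib

open MeasureTheory ProbabilityTheory
open scoped ENNReal

/-- A (finite simple) graph is unicyclic if it is connected and has as many edges as vertices. -/
def IsUnicyclic {V : Type*} (G : SimpleGraph V) : Prop :=
  G.Connected ∧ Nat.card G.edgeSet = Nat.card V

/-- For a cycle `c` of `G` and a vertex `v` (on `c`), the vertex set of the connected component
containing `v` of the graph obtained from `G` by deleting the edges of `c`. -/
def hangingTree {V : Type*} (G : SimpleGraph V) {u : V} (c : G.Walk u u) (v : V) : Set V :=
  ((G.deleteEdges {e | e ∈ c.edges}).connectedComponentMk v).supp

section RandomWalk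

variable {V : Type*} [Fintype V] [MeasurableSpace V] [DiscreteMeasurableSpace V]

open Classical in
/-- One step of the simple random walk from `v`: the uniform distribution on the neighbours of `v`
(the walk stays put at an isolated vertex). -/
noncomputable def stepMeasure (G : SimpleGraph V) (v : V) : Measure V :=
  if (G.neighborSet v).Nonempty then uniformOn (G.neighborSet v) else Measure.dirac v

/-- The transition kernel of the simple random walk on `G`. -/
noncomputable def stepKernel (G : SimpleGraph V) : Kernel V V where
  toFun := stepMeasure G
  measurable' := Measurable.of_discrete

instance isMarkovKernel_stepKernel (G : SimpleGraph V) : IsMarkovKernel (stepKernel G) := by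
  refine ⟨fun v => ?_⟩
  change IsProbabilityMeasure (stepMeasure G v)
  unfold stepMeasure
  split_ifs with h
  · exact isProbabilityMeasure_uniformOn (Set.toFinite _) h
  · infer_instance

/-- The transition kernel from the history `(X_0, …, X_k)` to `X_{k+1}`, which depends on
`X_k` only. -/
noncomputable def historyKernel (G : SimpleGraph V) (k : ℕ) :
    Kernel ((i : Finset.Iic k) → V) V :=
  (stepKernel G).comap (fun h => h ⟨k, Finset.mem_Iic.2 le_rfl⟩) (measurable_pi_apply _)

instance isMarkovKernel_historyKernel (G : SimpleGraph V) (k : ℕ) :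
    IsMarkovKernel (historyKernel G k) := by
  unfold historyKernel
  infer_instance

/-- The law, on the space `ℕ → V` of trajectories, of the simple random walk on `G` started at
`x`. -/
noncomputable def walkMeasure (G : SimpleGraph V) (x : V) : Measure (ℕ → V) :=
  Kernel.trajMeasure (X := fun _ => V) (Measure.dirac x) (historyKernel G)

/-- The hitting time `T_y = inf {k ≥ 0 : X_k = y}` of `y` (`⊤` if `y` is never reached). -/
noncomputable def hitTime (y : V) (ω : ℕ → V) : ℕ∞ :=
  sInf {t : ℕ∞ | ∃ k : ℕ, t = k ∧ ω k = y}

/-- The expected hitting time `H_{xy}` of `y` for the simple random walk on `G` started at `x`. -/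
noncomputable def expHit (G : SimpleGraph V) (x y : V) : ℝ≥0∞ :=
  ∫⁻ ω, (hitTime y ω : ℝ≥0∞) ∂(walkMeasure G x)

/-- The cover cost `CC(x) = ∑_y H_{xy}`. -/
noncomputable def coverCost (G : SimpleGraph V) (x : V) : ℝ≥0∞ :=
  ∑ y, expHit G x y

end RandomWalk

/-! ### Hitting times of the walk and the Laplacian of the cover cost. -/

section HittingTimes

variable {V : Type*} [Fintype V] [MeasurableSpace V] [DiscreteMeasurableSpace V]

/-! Write `n = |V| = |E|` and let `h` be the distance to the cycle. The point is that `CC + n * h`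
is constant, so a smaller height means a larger cover cost. First-step analysis gives `H_{·y}` the
Laplacian `deg x` off `y`; since a Laplacian sums to zero, its value at `y` is `deg y - 2|E|`.
Summing over `y`, the Laplacian of `CC` is `n * deg x - 2|E| = n * (deg x - 2)`
(`degree_mul_toReal_coverCost_sub`). Subtraction requires finite hitting times (`expHit_ne_top`).
Counting edges shows that off the cycle `G` consists of parent edges, whence `∑ w ~ x, (h w - h x) =
deg x - 2` (`sum_neighborFinset_height_sub`). The two Laplacians cancel in `CC + n * h`, and the
maximum principle makes it constant. -/

lemma lintegral_stepMeasure (G : SimpleGraph V) [DecidableRel G.Adj] {v : V}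
    (hv : (G.neighborSet v).Nonempty) (g : V → ℝ≥0∞) :
    ∫⁻ w, g w ∂(stepMeasure G v) = (G.degree v : ℝ≥0∞)⁻¹ * ∑ w ∈ G.neighborFinset v, g w := by
  classical
  have hm : MeasurableSet (G.neighborSet v) := MeasurableSet.of_discrete
  rw [stepMeasure, if_pos hv, uniformOn, ProbabilityTheory.cond, lintegral_smul_measure,
    Measure.count_apply hm]
  congr 1
  · rw [← SimpleGraph.card_neighborSet_eq_degree, Set.encard_eq_coe_toFinset_card]
    simp
  · have e : G.neighborSet v = (G.neighborFinset v : Set V) := by simp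
    simp only [e, lintegral_finset, Measure.count_singleton, mul_one]

lemma degree_mul_lintegral_stepMeasure (G : SimpleGraph V) [DecidableRel G.Adj] {v : V}
    (hv : (G.neighborSet v).Nonempty) (g : V → ℝ≥0∞) :
    (G.degree v : ℝ≥0∞) * ∫⁻ w, g w ∂(stepMeasure G v) = ∑ w ∈ G.neighborFinset v, g w := by
  have h0 : G.degree v ≠ 0 := ((G.degree_pos_iff_exists_adj v).2 hv).ne'
  rw [lintegral_stepMeasure G hv, ← mul_assoc,
    ENNReal.mul_inv_cancel (by exact_mod_cast h0) (ENNReal.natCast_ne_top _), one_mul]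

/-- The Markov property of the walk at time `n`. -/
lemma lintegral_walkMeasure_succ (G : SimpleGraph V) (x : V) (n : ℕ)
    (f : ((i : Finset.Iic n) → V) → ℝ≥0∞) (g : V → ℝ≥0∞) :
    ∫⁻ ω, f (Preorder.frestrictLe n ω) * g (ω (n + 1)) ∂(walkMeasure G x) =
      ∫⁻ ω, f (Preorder.frestrictLe n ω) * ∫⁻ w, g w ∂(stepMeasure G (ω n))
        ∂(walkMeasure G x) := by
  have key := Kernel.map_frestrictLe_trajMeasure_compProd_eq_map_trajMeasure
    (μ₀ := Measure.dirac x) (X := fun _ => V) (κ := historyKernel G) (a := n)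
  have hf : Measurable f := Measurable.of_discrete
  have hg : Measurable g := Measurable.of_discrete
  have h2 : Measurable fun p : ((i : Finset.Iic n) → V) × V => f p.1 * g p.2 := by fun_prop
  have h3 := congrArg (fun μ => ∫⁻ p, f p.1 * g p.2 ∂μ) key
  rw [Measure.lintegral_compProd h2, lintegral_map h2 (by fun_prop),
    lintegral_map (by fun_prop) (by fun_prop)] at h3
  rw [walkMeasure, ← h3]
  refine lintegral_congr fun ω => ?_
  change ∫⁻ w, f (Preorder.frestrictLe n ω) * g w ∂(stepMeasure G (ω n)) = _
  exact lintegral_const_mul _ hg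

lemma lintegral_walkMeasure_zero (G : SimpleGraph V) (x : V) (g : V → ℝ≥0∞) :
    ∫⁻ ω, g (ω 0) ∂(walkMeasure G x) = g x := by
  have hw : walkMeasure G x = Kernel.traj (X := fun _ => V) (historyKernel G) 0 (fun _ => x) := by
    have hm : Measurable (MeasurableEquiv.piUnique fun _ : Finset.Iic 0 => V).symm := by fun_prop
    have hd := Measure.map_dirac' hm x
    rw [walkMeasure, Kernel.trajMeasure]
    erw [hd]
    rw [Measure.dirac_bind (Kernel.measurable _)]
    rfl
  have hk := Kernel.traj_map_frestrictLe_apply (X := fun _ => V) (κ := historyKernel G) 0 0 (fun _ => x)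
  rw [Kernel.partialTraj_self, Kernel.id_apply] at hk
  have h := congrArg (fun μ => ∫⁻ h, g (h ⟨0, by simp⟩) ∂μ) hk
  rw [lintegral_map Measurable.of_discrete (by fun_prop),
    lintegral_dirac' _ Measurable.of_discrete] at h
  rw [hw]
  exact h

open Classical in
/-- The indicator function of the complement of `{y}`. -/
noncomputable def offInd (y v : V) : ℝ≥0∞ := if v = y then 0 else 1

/-- The transition operator of the walk killed at `y`. -/
noncomputable def killedStep (G : SimpleGraph V) (y : V) (φ : V → ℝ≥0∞) (v : V) : ℝ≥0∞ :=
  ∫⁻ w, offInd y w * φ w ∂(stepMeasure G v)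

/-- The probability that the walk started at `x` does not visit `y` up to time `n`. -/
noncomputable def survival (G : SimpleGraph V) (y : V) (n : ℕ) (x : V) : ℝ≥0∞ :=
  offInd y x * (killedStep G y)^[n] 1 x

/-- The function `φ` is arbitrary so that, in the induction, the Markov property can absorb the last
factor into it. -/
lemma lintegral_prod_offInd (G : SimpleGraph V) (x y : V) (n : ℕ) (φ : V → ℝ≥0∞) :
    ∫⁻ ω, (∏ i ∈ Finset.Iic n, offInd y (ω i)) * φ (ω n) ∂(walkMeasure G x) =
      offInd y x * (killedStep G y)^[n] φ x := by
  induction n generalizing φ with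
  | zero =>
    have h0 : Finset.Iic 0 = {0} := rfl
    simpa [h0] using lintegral_walkMeasure_zero G x (fun v => offInd y v * φ v)
  | succ n ih =>
    have h := lintegral_walkMeasure_succ G x n (fun h => ∏ i, offInd y (h i))
      (fun v => offInd y v * φ v)
    have e : ∀ ω : ℕ → V, ∏ i : Finset.Iic n, offInd y (Preorder.frestrictLe n ω i) =
        ∏ i ∈ Finset.Iic n, offInd y (ω i) :=
      fun ω => Finset.prod_coe_sort (Finset.Iic n) (fun i => offInd y (ω i))
    simp only [e] at h
    rw [Function.iterate_succ_apply, ← ih]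
    refine Eq.trans (lintegral_congr fun ω => ?_) h
    rw [← mul_assoc]
    congr 1
    have hI : Finset.Iic (n + 1) = insert (n + 1) (Finset.Iic n) := by
      ext i
      simp only [Finset.mem_Iic, Finset.mem_insert]
      omega
    rw [hI, Finset.prod_insert (by simp), mul_comm]

lemma lintegral_prod_offInd_eq_survival (G : SimpleGraph V) (x y : V) (n : ℕ) :
    ∫⁻ ω, ∏ i ∈ Finset.Iic n, offInd y (ω i) ∂(walkMeasure G x) = survival G y n x := by
  simpa [survival] using lintegral_prod_offInd G x y n 1

omit [Fintype V] [DiscreteMeasurableSpace V] in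
lemma survival_zero (G : SimpleGraph V) (y x : V) : survival G y 0 x = offInd y x := by
  simp [survival]

omit [Fintype V] [DiscreteMeasurableSpace V] in
lemma survival_succ (G : SimpleGraph V) (y : V) (n : ℕ) (x : V) :
    survival G y (n + 1) x = offInd y x * ∫⁻ w, survival G y n w ∂(stepMeasure G x) := by
  rw [survival, Function.iterate_succ_apply']
  rfl

lemma tsum_indicator_lt_eq (t : ℕ∞) :
    ∑' n : ℕ, (if (n : ℕ∞) < t then (1 : ℝ≥0∞) else 0) = t := by
  induction t using ENat.recTopCoe with
  | top => simp
  | coe k =>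
    rw [tsum_eq_sum (s := Finset.range k) (by simp)]
    simp +contextual [Finset.filter_true_of_mem]

omit [Fintype V] [MeasurableSpace V] [DiscreteMeasurableSpace V] in
lemma prod_offInd_eq (y : V) (n : ℕ) (ω : ℕ → V) :
    ∏ i ∈ Finset.Iic n, offInd y (ω i) = if (n : ℕ∞) < hitTime y ω then 1 else 0 := by
  have h : (n : ℕ∞) < hitTime y ω ↔ ∀ i ∈ Finset.Iic n, ω i ≠ y := by
    constructor
    · intro h i hi hy
      have : hitTime y ω ≤ i := sInf_le ⟨i, rfl, hy⟩
      have := h.trans_le this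
      simp at this hi
      omega
    · intro h
      refine lt_of_lt_of_le (b := ((n + 1 : ℕ) : ℕ∞)) (by exact_mod_cast Nat.lt_succ_self n) ?_
      refine le_sInf ?_
      rintro _ ⟨k, rfl, hk⟩
      by_contra hc
      have : k < n + 1 := by exact_mod_cast not_le.1 hc
      exact h k (by simp; omega) hk
  split_ifs with h1
  · exact Finset.prod_eq_one fun i hi => if_neg (h.1 h1 i hi)
  · rw [h] at h1
    push Not at h1
    obtain ⟨i, hi, hy⟩ := h1
    exact Finset.prod_eq_zero hi (if_pos hy)

/-- Tail-sum formula: `T_y` is the number of `n` with `n < T_y`, and that event has probability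
`survival G y n x`. -/
lemma expHit_eq_tsum (G : SimpleGraph V) (x y : V) :
    expHit G x y = ∑' n, survival G y n x := by
  have hm : ∀ n, Measurable fun ω : ℕ → V => ∏ i ∈ Finset.Iic n, offInd y (ω i) := by
    intro n
    have : Measurable (offInd y) := Measurable.of_discrete
    fun_prop
  simp_rw [← lintegral_prod_offInd_eq_survival]
  rw [← lintegral_tsum (fun n => (hm n).aemeasurable)]
  simp_rw [prod_offInd_eq, tsum_indicator_lt_eq]
  rfl

lemma expHit_self (G : SimpleGraph V) (y : V) : expHit G y y = 0 := by
  rw [expHit_eq_tsum]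
  simp [survival, offInd]

lemma expHit_of_ne (G : SimpleGraph V) {x y : V} (h : x ≠ y) :
    expHit G x y = 1 + ∫⁻ w, expHit G w y ∂(stepMeasure G x) := by
  have hx : offInd y x = 1 := if_neg h
  simp_rw [expHit_eq_tsum]
  rw [tsum_eq_zero_add' ENNReal.summable, survival_zero, hx,
    lintegral_tsum (fun n => Measurable.of_discrete.aemeasurable)]
  simp_rw [survival_succ, hx, one_mul]

omit [MeasurableSpace V] [DiscreteMeasurableSpace V] in
lemma sum_sum_neighborFinset {M : Type*} [AddCommMonoid M] (G : SimpleGraph V)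
    [DecidableRel G.Adj] (f : V → M) :
    ∑ x, ∑ w ∈ G.neighborFinset x, f w = ∑ w, G.degree w • f w := by
  rw [Finset.sum_comm' (t' := Finset.univ) (s' := fun w => G.neighborFinset w)
    (by simp [SimpleGraph.adj_comm])]
  simp

lemma degree_mul_survival_succ (G : SimpleGraph V) [DecidableRel G.Adj] {x : V}
    (hx : (G.neighborSet x).Nonempty) (y : V) (n : ℕ) :
    G.degree x * survival G y (n + 1) x =
      offInd y x * ∑ w ∈ G.neighborFinset x, survival G y n w := by
  rw [survival_succ, mul_left_comm, degree_mul_lintegral_stepMeasure G hx]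

/-- The degree measure is invariant under the walk, so the weighted surviving mass drops only by the
term at `y` that killing removes. -/
lemma sum_degree_mul_survival_succ (G : SimpleGraph V) [DecidableRel G.Adj]
    (hG : ∀ v, (G.neighborSet v).Nonempty) (y : V) (n : ℕ) :
    ∑ x, G.degree x * survival G y (n + 1) x + ∑ w ∈ G.neighborFinset y, survival G y n w =
      ∑ x, G.degree x * survival G y n x := by
  classical
  simp_rw [degree_mul_survival_succ G (hG _), ← nsmul_eq_mul]
  rw [← sum_sum_neighborFinset, ← Finset.add_sum_erase _ _ (Finset.mem_univ y),
    ← Finset.add_sum_erase _ _ (Finset.mem_univ y), offInd, if_pos rfl, zero_mul, zero_add,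
    add_comm]
  congr 1
  refine Finset.sum_congr rfl fun x hx => ?_
  rw [offInd, if_neg (Finset.ne_of_mem_erase hx), one_mul]

/-- The mass losses telescope, so their total is at most the initial mass, which is finite. -/
lemma sum_neighborFinset_expHit_le (G : SimpleGraph V) [DecidableRel G.Adj]
    (hG : ∀ v, (G.neighborSet v).Nonempty) (y : V) :
    ∑ w ∈ G.neighborFinset y, expHit G w y ≤ ∑ x, G.degree x * survival G y 0 x := by
  simp_rw [expHit_eq_tsum]
  rw [← Summable.tsum_finsetSum (fun _ _ => ENNReal.summable)]
  refine ENNReal.tsum_le_of_sum_range_le fun N => ?_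
  suffices h : ∑ x, G.degree x * survival G y N x +
      ∑ n ∈ Finset.range N, ∑ w ∈ G.neighborFinset y, survival G y n w =
      ∑ x, G.degree x * survival G y 0 x from h ▸ le_add_self
  induction N with
  | zero => simp
  | succ N ih =>
    rw [Finset.sum_range_succ, add_comm (∑ n ∈ Finset.range N, _), ← add_assoc,
      sum_degree_mul_survival_succ G hG, ih]

/-- First-step analysis of the expected hitting time. -/
lemma degree_mul_expHit (G : SimpleGraph V) [DecidableRel G.Adj] {x y : V}
    (hx : (G.neighborSet x).Nonempty) (h : x ≠ y) :
    G.degree x * expHit G x y = G.degree x + ∑ w ∈ G.neighborFinset x, expHit G w y := by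
  rw [expHit_of_ne G h, mul_add, mul_one, degree_mul_lintegral_stepMeasure G hx]

lemma expHit_ne_top_of_adj_target (G : SimpleGraph V)
    (hG : ∀ v, (G.neighborSet v).Nonempty) {y w : V} (h : G.Adj y w) : expHit G w y ≠ ⊤ := by
  classical
  have h1 : ∑ x, G.degree x * survival G y 0 x ≠ ⊤ := by
    refine ENNReal.sum_ne_top.2 fun x _ => ENNReal.mul_ne_top (ENNReal.natCast_ne_top _) ?_
    rw [survival_zero, offInd]
    split_ifs <;> simp
  refine ne_top_of_le_ne_top h1 (le_trans ?_ (sum_neighborFinset_expHit_le G hG y))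
  exact Finset.single_le_sum (f := fun w => expHit G w y) (fun _ _ => zero_le)
    ((G.mem_neighborFinset y w).2 h)

lemma expHit_ne_top (G : SimpleGraph V) (hc : G.Connected)
    (hG : ∀ v, (G.neighborSet v).Nonempty) (x y : V) : expHit G x y ≠ ⊤ := by
  classical
  obtain ⟨p⟩ := hc x y
  induction p with
  | nil => simp [expHit_self]
  | @cons u v w h p ih =>
    by_cases hv : v = w
    · subst hv
      exact expHit_ne_top_of_adj_target G hG h.symm
    · have h1 := degree_mul_expHit G (hG v) hv
      have h2 : (G.degree v : ℝ≥0∞) * expHit G v w ≠ ⊤ :=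
        ENNReal.mul_ne_top (ENNReal.natCast_ne_top _) ih
      rw [h1, ENNReal.add_ne_top, ENNReal.sum_ne_top] at h2
      exact h2.2 u ((G.mem_neighborFinset v u).2 h.symm)

/-- The graph Laplacian of the hitting time of `y`: it equals `deg x` off `y`, and the value at `y`
is determined by the fact that the Laplacian sums to zero. -/
lemma degree_mul_toReal_expHit_sub (G : SimpleGraph V) [DecidableRel G.Adj] [DecidableEq V]
    (hc : G.Connected) (hG : ∀ v, (G.neighborSet v).Nonempty) (x y : V) :
    G.degree x * (expHit G x y).toReal - ∑ w ∈ G.neighborFinset x, (expHit G w y).toReal =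
      G.degree x - if x = y then 2 * (G.edgeFinset.card : ℝ) else 0 := by
  have hf := expHit_ne_top G hc hG
  set L : V → ℝ := fun x =>
    G.degree x * (expHit G x y).toReal - ∑ w ∈ G.neighborFinset x, (expHit G w y).toReal with hL
  have hne : ∀ x, x ≠ y → L x = G.degree x := by
    intro x hxy
    have h := congrArg ENNReal.toReal (degree_mul_expHit G (hG x) hxy)
    rw [ENNReal.toReal_mul, ENNReal.toReal_add (ENNReal.natCast_ne_top _)
      (ENNReal.sum_ne_top.2 fun w _ => hf w y), ENNReal.toReal_sum fun w _ => hf w y] at h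
    simp only [ENNReal.toReal_natCast] at h
    simp only [hL]
    linarith
  have hsum : ∑ x, L x = 0 := by
    simp only [hL, Finset.sum_sub_distrib, sum_sum_neighborFinset, nsmul_eq_mul, sub_self]
  have hdeg : ∑ x, (G.degree x : ℝ) = 2 * G.edgeFinset.card := by
    exact_mod_cast G.sum_degrees_eq_twice_card_edges
  change L x = _
  by_cases hxy : x = y
  · subst hxy
    rw [← Finset.add_sum_erase _ _ (Finset.mem_univ x)] at hsum hdeg
    rw [Finset.sum_congr rfl fun z hz => hne z (Finset.ne_of_mem_erase hz)] at hsum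
    rw [if_pos rfl]
    linarith
  · rw [if_neg hxy, hne x hxy, sub_zero]

lemma coverCost_ne_top (G : SimpleGraph V) (hc : G.Connected)
    (hG : ∀ v, (G.neighborSet v).Nonempty) (x : V) : coverCost G x ≠ ⊤ :=
  ENNReal.sum_ne_top.2 fun y _ => expHit_ne_top G hc hG x y

/-- The graph Laplacian of the cover cost. -/
lemma degree_mul_toReal_coverCost_sub (G : SimpleGraph V) [DecidableRel G.Adj]
    (hc : G.Connected) (hG : ∀ v, (G.neighborSet v).Nonempty) (x : V) :
    G.degree x * (coverCost G x).toReal - ∑ w ∈ G.neighborFinset x, (coverCost G w).toReal =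
      Fintype.card V * G.degree x - 2 * G.edgeFinset.card := by
  classical
  have e : ∀ v, (coverCost G v).toReal = ∑ y, (expHit G v y).toReal := fun v =>
    ENNReal.toReal_sum fun y _ => expHit_ne_top G hc hG v y
  simp_rw [e]
  rw [Finset.mul_sum, Finset.sum_comm, ← Finset.sum_sub_distrib]
  -- Summed over the targets `y`, the correction `2|E|` appears exactly once, at `y = x`.
  simp_rw [degree_mul_toReal_expHit_sub G hc hG]
  simp

end HittingTimes

/-! ### Heights and parent edges over the cycle. -/

namespace SimpleGraph

variable {V : Type*} {G : SimpleGraph V}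

/-- In a connected graph, every vertex off a nonempty set `S` has a neighbour one step closer
to `S`. -/
lemma Connected.exists_height_parent (hc : G.Connected) {S : Set V} (hS : S.Nonempty) :
    ∃ (h : V → ℕ) (p : V → V), (∀ v ∈ S, h v = 0 ∧ p v = v) ∧
      (∀ v ∉ S, G.Adj v (p v) ∧ h v = h (p v) + 1) ∧ ∀ v, ∀ w ∈ S, h v ≤ G.dist v w := by
  classical
  have hle : ∀ v, ∀ w ∈ S, sInf (G.dist v '' S) ≤ G.dist v w :=
    fun v w hw => Nat.sInf_le ⟨w, hw, rfl⟩
  have hp : ∀ v, ∃ w, (v ∈ S → w = v) ∧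
      (v ∉ S → G.Adj v w ∧ sInf (G.dist v '' S) = sInf (G.dist w '' S) + 1) := by
    intro v
    by_cases hv : v ∈ S
    · exact ⟨v, fun _ => rfl, fun h => absurd hv h⟩
    -- The parent is the first step of a geodesic to a nearest point of `S`.
    obtain ⟨s, hs, hvs⟩ := Nat.sInf_mem (hS.image (G.dist v))
    obtain ⟨q, hq⟩ := (hc v s).exists_walk_length_eq_dist
    cases q with
    | nil => exact absurd hs hv
    | @cons _ w _ hvw q =>
      refine ⟨w, fun h => absurd h hv, fun _ => ⟨hvw, ?_⟩⟩
      rw [Walk.length_cons] at hq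
      have h1 := dist_le q
      have h2 := hle w s hs
      obtain ⟨t, ht, hwt⟩ := Nat.sInf_mem (hS.image (G.dist w))
      have h3 := hle v t ht
      have h4 := hc.dist_triangle (u := v) (v := w) (w := t)
      have h5 : G.dist v w = 1 := dist_eq_one_iff_adj.2 hvw
      omega
  choose p hp1 hp2 using hp
  refine ⟨fun v => sInf (G.dist v '' S), p, fun v hv => ⟨?_, hp1 v hv⟩, hp2, hle⟩
  have := hle v v hv
  rw [dist_self] at this
  exact Nat.le_zero.1 this

lemma Walk.IsCycle.card_support_toFinset [DecidableEq V] {u : V} {c : G.Walk u u}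
    (hc : c.IsCycle) : c.support.toFinset.card = c.length := by
  have h : c.support.toFinset = c.support.tail.toFinset := by
    have hu : u ∈ c.support.tail := c.end_mem_tail_support hc.not_nil
    rw [← Walk.cons_tail_support, List.toFinset_cons, List.tail_cons]
    exact Finset.insert_eq_of_mem (List.mem_toFinset.2 hu)
  rw [h, List.toFinset_card_of_nodup hc.support_nodup, List.length_tail, Walk.length_support]
  simp

section Parent

variable {u : V} {c : G.Walk u u} {h : V → ℕ} {p : V → V}

/-- In a unicyclic graph, every edge is on the cycle or joins a vertex to its parent. -/
lemma mem_edges_or_eq_parent [Fintype V] (hcard : Nat.card G.edgeSet = Nat.card V)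
    (hc : c.IsCycle) (hp : ∀ v ∉ c.support, G.Adj v (p v) ∧ h v = h (p v) + 1)
    {e : Sym2 V} (he : e ∈ G.edgeSet) : e ∈ c.edges ∨ ∃ v ∉ c.support, e = s(v, p v) := by
  classical
  set A := c.edges.toFinset with hA
  set S := c.support.toFinset with hS
  set B := Sᶜ.image (fun v => s(v, p v)) with hB
  have hSp : ∀ v ∈ Sᶜ, G.Adj v (p v) ∧ h v = h (p v) + 1 := fun v hv => hp v (by simpa [hS] using hv)
  have hcA : A.card = c.length := by
    rw [List.toFinset_card_of_nodup hc.edges_nodup, Walk.length_edges]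
  have hcB : B.card = Fintype.card V - c.length := by
    rw [Finset.card_image_of_injOn, Finset.card_compl, hc.card_support_toFinset]
    -- Two distinct vertices sharing a parent edge would be each other's parents, each one higher
    -- than the other.
    intro v hv w hw hvw
    have h1 := (hSp v hv).2
    have h2 := (hSp w hw).2
    rcases Sym2.eq_iff.1 hvw with ⟨h3, -⟩ | ⟨h3, h4⟩
    · exact h3
    · rw [h4] at h1
      rw [← h3] at h2
      omega
  have hdis : Disjoint A B := by
    refine Finset.disjoint_left.2 fun e heA heB => ?_
    obtain ⟨v, hv, rfl⟩ := Finset.mem_image.1 heB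
    rw [Finset.mem_compl, List.mem_toFinset] at hv
    exact hv (c.fst_mem_support_of_mem_edges (List.mem_toFinset.1 heA))
  have hsub : A ∪ B ⊆ G.edgeFinset := by
    intro e he
    rw [mem_edgeFinset]
    rcases Finset.mem_union.1 he with he | he
    · exact c.edges_subset_edgeSet (List.mem_toFinset.1 he)
    · obtain ⟨v, hv, rfl⟩ := Finset.mem_image.1 he
      exact (hSp v hv).1
  have hlen : c.length ≤ Fintype.card V := hc.card_support_toFinset ▸ Finset.card_le_univ _
  have hE : G.edgeFinset.card = Fintype.card V := by
    rw [← Nat.card_eq_fintype_card (α := V), ← hcard, Nat.card_eq_fintype_card, edgeFinset_card]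
  -- Cycle edges and parent edges number `c.length + (|V| - c.length) = |E|`, so no other edge
  -- exists.
  have heq : A ∪ B = G.edgeFinset := by
    refine Finset.eq_of_subset_of_card_le hsub ?_
    rw [Finset.card_union_of_disjoint hdis, hcA, hcB, hE]
    omega
  have heAB : e ∈ A ∪ B := heq ▸ mem_edgeFinset.2 he
  rcases Finset.mem_union.1 heAB with he | he
  · exact Or.inl (List.mem_toFinset.1 he)
  · obtain ⟨v, hv, rfl⟩ := Finset.mem_image.1 he
    exact Or.inr ⟨v, by simpa [hS] using hv, rfl⟩

/-- The graph Laplacian of the height over the cycle. -/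
lemma sum_neighborFinset_height_sub [Fintype V] [DecidableRel G.Adj] (hc : c.IsCycle)
    (h0 : ∀ v ∈ c.support, h v = 0 ∧ p v = v)
    (hp : ∀ v ∉ c.support, G.Adj v (p v) ∧ h v = h (p v) + 1)
    (hedge : ∀ e ∈ G.edgeSet, e ∈ c.edges ∨ ∃ v ∉ c.support, e = s(v, p v)) (x : V) :
    ∑ w ∈ G.neighborFinset x, ((h w : ℝ) - h x) = G.degree x - 2 := by
  classical
  -- After subtracting 1, children contribute 0. The remainder is `-2`: from the two cycle edges at
  -- `-1` each if `x` is on the cycle, otherwise from the parent alone.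
  suffices hs : ∑ w ∈ G.neighborFinset x, ((h w : ℝ) - h x - 1) = -2 by
    rw [Finset.sum_sub_distrib] at hs
    simp only [Finset.sum_const, card_neighborFinset_eq_degree, nsmul_eq_mul, mul_one] at hs
    linarith
  have hup : ∀ w, G.Adj x w → s(x, w) ∉ c.edges → ¬ (x ∉ c.support ∧ w = p x) →
      (h w : ℝ) - h x - 1 = 0 := by
    intro w hxw hxe hxp
    obtain hh | ⟨v, hv, hvw⟩ := hedge _ ((G.mem_edgeSet).2 hxw)
    · exact absurd hh hxe
    · rcases Sym2.eq_iff.1 hvw with ⟨rfl, hw⟩ | ⟨hx, rfl⟩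
      · exact absurd ⟨hv, hw⟩ hxp
      · rw [(hp w hv).2, ← hx]
        push_cast
        ring
  by_cases hx : x ∈ c.support
  · have hterm : ∀ w ∈ G.neighborFinset x, (h w : ℝ) - h x - 1 =
        if s(x, w) ∈ c.edges then -1 else 0 := by
      intro w hw
      split_ifs with hxw
      · rw [(h0 x hx).1, (h0 w (c.snd_mem_support_of_mem_edges hxw)).1]
        simp
      · exact hup w ((G.mem_neighborFinset x w).1 hw) hxw fun hn => hn.1 hx
    have hset : ((G.neighborFinset x).filter (fun w => s(x, w) ∈ c.edges) : Set V) =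
        c.toSubgraph.neighborSet x := by
      ext w
      simp only [Finset.coe_filter, mem_neighborFinset, Set.mem_ofPred_eq,
        Subgraph.mem_neighborSet, ← Walk.mem_edges_toSubgraph, Subgraph.mem_edgeSet]
      exact ⟨fun hh => hh.2, fun hh => ⟨hh.adj_sub, hh⟩⟩
    have hcard : ((G.neighborFinset x).filter (fun w => s(x, w) ∈ c.edges)).card = 2 := by
      rw [← Set.ncard_coe_finset, hset]
      exact hc.ncard_neighborSet_toSubgraph_eq_two hx
    rw [Finset.sum_congr rfl hterm, ← Finset.sum_filter, Finset.sum_const, hcard]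
    norm_num
  · rw [Finset.sum_eq_single (p x)]
    · rw [(hp x hx).2]
      push_cast
      ring
    · intro w hw hne
      exact hup w ((G.mem_neighborFinset x w).1 hw)
        (fun hh => hx (c.fst_mem_support_of_mem_edges hh)) fun hn => hne hn.2
    · exact fun hn => absurd ((G.mem_neighborFinset x _).2 (hp x hx).1) hn

/-- The height of a vertex is its distance to the root of its hanging tree. -/
lemma dist_eq_height_of_mem_hangingTree (hconn : G.Connected)
    (h0 : ∀ v ∈ c.support, h v = 0 ∧ p v = v)
    (hp : ∀ v ∉ c.support, G.Adj v (p v) ∧ h v = h (p v) + 1)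
    (hle : ∀ v, ∀ w ∈ c.support, h v ≤ G.dist v w)
    (hedge : ∀ e ∈ G.edgeSet, e ∈ c.edges ∨ ∃ v ∉ c.support, e = s(v, p v))
    {x v : V} (hv : v ∈ c.support) (hx : x ∈ hangingTree G c v) : G.dist x v = h x := by
  -- `p^[h w] w` is the cycle vertex reached by following parents. It is unchanged along non-cycle
  -- edges, so on the hanging tree of `v` it equals `v`.
  have hroot : ∀ w ∉ c.support, p^[h w] w = p^[h (p w)] (p w) := by
    intro w hw
    rw [(hp w hw).2, Function.iterate_succ_apply]
  have hstep : ∀ a b, (G.deleteEdges {e | e ∈ c.edges}).Adj a b →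
      p^[h a] a = p^[h b] b := by
    intro a b hab
    rw [deleteEdges_adj] at hab
    obtain hh | ⟨w, hw, hvw⟩ := hedge _ ((G.mem_edgeSet).2 hab.1)
    · exact absurd hh hab.2
    · rcases Sym2.eq_iff.1 hvw with ⟨rfl, rfl⟩ | ⟨rfl, rfl⟩
      · exact hroot _ hw
      · exact (hroot _ hw).symm
  have hwalk : ∀ a b, (G.deleteEdges {e | e ∈ c.edges}).Walk a b →
      p^[h a] a = p^[h b] b := by
    intro a b q
    induction q with
    | nil => rfl
    | cons hab _ ih => exact (hstep _ _ hab).trans ih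
  have hdist : ∀ n w, h w = n → G.dist w (p^[n] w) ≤ n := by
    intro n
    induction n with
    | zero => simp
    | succ n ih =>
      intro w hw
      have hws : w ∉ c.support := fun hh => by
        rw [(h0 w hh).1] at hw
        omega
      obtain ⟨h1, h2⟩ := hp w hws
      have h3 := ih (p w) (by omega)
      have h4 := hconn.dist_triangle (u := w) (v := p w) (w := p^[n] (p w))
      have h5 : G.dist w (p w) = 1 := dist_eq_one_iff_adj.2 h1
      rw [Function.iterate_succ_apply]
      omega
  obtain ⟨q⟩ : (G.deleteEdges {e | e ∈ c.edges}).Reachable x v := ConnectedComponent.exact hx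
  have h1 := hwalk x v q
  rw [(h0 v hv).1, Function.iterate_zero_apply] at h1
  exact le_antisymm (h1 ▸ hdist _ x rfl) (hle x v hv)

end Parent

/-- A function on a finite connected graph whose graph Laplacian vanishes is constant. -/
lemma Connected.eq_of_sum_sub_eq_zero [Fintype V] [DecidableRel G.Adj] (hc : G.Connected)
    {f : V → ℝ} (hf : ∀ x, ∑ w ∈ G.neighborFinset x, (f w - f x) = 0) (x y : V) :
    f x = f y := by
  have := hc.nonempty
  -- Maximum principle: at a maximum the differences are nonpositive with sum zero, hence all
  -- vanish, and the maximal value spreads along walks.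
  obtain ⟨m, -, hm⟩ := Finset.exists_max_image Finset.univ f Finset.univ_nonempty
  have hadj : ∀ a b, G.Adj a b → f a = f m → f b = f m := by
    intro a b hab ha
    have h := (Finset.sum_eq_zero_iff_of_nonpos fun w _ => by
      have := hm w (Finset.mem_univ w)
      linarith).1 (hf a) b ((G.mem_neighborFinset a b).2 hab)
    linarith
  have hwalk : ∀ a b, G.Walk a b → f a = f m → f b = f m := by
    intro a b q
    induction q with
    | nil => exact id
    | cons hab _ ih => exact fun ha => ih (hadj _ _ hab ha)
  have hall : ∀ z, f z = f m := fun z => (hc m z).elim fun q => hwalk _ _ q rfl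
  rw [hall x, hall y]

end SimpleGraph

/-! ### Comparison of cover costs. -/

theorem mainTheorem11 {V : Type*} [Fintype V] [MeasurableSpace V] [DiscreteMeasurableSpace V]
    (G : SimpleGraph V) (hG : IsUnicyclic G)
    {u : V} (c : G.Walk u u) (hc : c.IsCycle)
    (vi vj : V) (hvi : vi ∈ c.support) (hvj : vj ∈ c.support)
    (x y : V) (hx : x ∈ hangingTree G c vi) (hy : y ∈ hangingTree G c vj) :
    G.dist x vi ≤ G.dist y vj ↔ coverCost G x ≥ coverCost G y := by
  classical
  obtain ⟨hconn, hcard⟩ := hG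
  have : Nontrivial V :=
    Fintype.one_lt_card_iff_nontrivial.1
      (lt_of_lt_of_le (by have := hc.three_le_length; omega)
        (hc.card_support_toFinset ▸ Finset.card_le_univ c.support.toFinset))
  have hnbr : ∀ v, (G.neighborSet v).Nonempty := fun v =>
    (G.degree_pos_iff_exists_adj v).1 (hconn.preconnected.degree_pos_of_nontrivial v)
  have hE : (G.edgeFinset.card : ℝ) = Fintype.card V := by
    rw [← Nat.card_eq_fintype_card (α := V), ← hcard, Nat.card_eq_fintype_card,
      SimpleGraph.edgeFinset_card]
  obtain ⟨h, p, h0, hp, hle⟩ :=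
    hconn.exists_height_parent (S := {v | v ∈ c.support}) ⟨u, c.start_mem_support⟩
  have hedge : ∀ e ∈ G.edgeSet, e ∈ c.edges ∨ ∃ v ∉ c.support, e = s(v, p v) :=
    fun _ he => SimpleGraph.mem_edges_or_eq_parent hcard hc hp he
  have hconst := hconn.eq_of_sum_sub_eq_zero
    (f := fun v => (coverCost G v).toReal + Fintype.card V * h v) (fun z => by
      have h1 := degree_mul_toReal_coverCost_sub G hconn hnbr z
      have h2 := SimpleGraph.sum_neighborFinset_height_sub hc h0 hp hedge z
      simp only [Finset.sum_sub_distrib, Finset.sum_add_distrib, ← Finset.mul_sum,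
        Finset.sum_const, SimpleGraph.card_neighborFinset_eq_degree, nsmul_eq_mul] at h2 ⊢
      rw [hE] at h1
      linear_combination (-1 : ℝ) * h1 + Fintype.card V * h2) x y
  have hn : (0 : ℝ) < Fintype.card V := by exact_mod_cast Fintype.card_pos
  rw [SimpleGraph.dist_eq_height_of_mem_hangingTree hconn h0 hp hle hedge hvi hx,
    SimpleGraph.dist_eq_height_of_mem_hangingTree hconn h0 hp hle hedge hvj hy, ge_iff_le,
    ← ENNReal.toReal_le_toReal (coverCost_ne_top G hconn hnbr y) (coverCost_ne_top G hconn hnbr x),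
    ← Nat.cast_le (α := ℝ), ← mul_le_mul_iff_right₀ hn]
  constructor <;> intro hh <;> linarith
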